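/- Let $d\ge 1$, let $\Sigma\in\mathbb{R}^{d\times d}$ be symmetric positive definite, let $\sigma=\mathcal N(0,\Sigma)$ and $\mu=\mathcal N(0,\mathbf I_d)$ on $\mathbb{R}^d$, let $1/2<\alpha<1$, and set $\gamma_k=1/(k+1)^{\alpha}$ for $k\ge 0$. For a probability measure $\nu$ on $\mathbb{R}^d$ and a unit vector $\theta$, let $\nu^\theta$ be the push-forward of $\nu$ under $x\mapsto\langle x,\theta\rangle$. For a probability measure $\rho$ with finite second moment, let $T_{\rho^\theta}^{\mu^\theta}=F_{\mu^\theta}^{-1}\circ F_{\rho^\theta}$ be the one-dimensional optimal transport map from $\rho^\theta$ to $\mu^\theta$ (with $F$ the distribution function and $F^{-1}$ the quantile function), and for an orthonormal basis $P=[\theta_1,\dots,\theta_d]$ of $\mathbb{R}^d$ let $$T_{\rho,P}(x)=\sum_{i=1}^d T_{\rho^{\theta_i}}^{\mu^{\theta_i}}(\langle\theta_i,x\rangle)\,\theta_i .$$ Let $(P_k)_{k\ge1}$ be i.i.d. random orthonormal bases of $\mathbb{R}^d$ distributed according to the Haar probability measure on the orthogonal group $O(d)$, and define the slice-matching iterates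 by $\sigma_0=\sigma$ and $$\sigma_{k+1}=\big((1-\gamma_k)\mathrm{Id}+\gamma_k T_{\sigma_k,P_{k+1}}\big)_\sharp\,\sigma_k ,\qquad k\ge 0 .$$ Let $$\mathscr F(\rho)=\frac d2\,SW_2^2(\rho,\mu)=\frac d2\int_{\mathbb S^{d-1}}W_2^2(\rho^\theta,\mu^\theta)\,\mathrm d\mathcal U(\theta),$$ where $W_2$ is the 2-Wasserstein distance and $\mathcal U$ is the uniform probability distribution on the unit sphere $\mathbb S^{d-1}$. Then there exists $C>0$, depending only on $d$, $\Sigma$ and $\alpha$, such that for all $k\ge1$ the function $\mathscr F(\sigma_k)$ is a random variable and $$\mathbb E[\mathscr F(\sigma_k)]\le\frac{C}{k^{2\alpha-1}} .$$ -/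

import Mathlib

open MeasureTheory ProbabilityTheory
open scoped ENNReal

noncomputable section

namespace SliceMatching

/-- The orthogonal group `O(d)`, i.e. the space of orthonormal bases of `ℝ^d` (as the columns of a
matrix), carries its Borel σ-algebra. -/
instance instMeasurableSpaceOrthogonalGroup (d : ℕ) :
    MeasurableSpace (Matrix.orthogonalGroup (Fin d) ℝ) :=
  borel (Matrix.orthogonalGroup (Fin d) ℝ)

instance instBorelSpaceOrthogonalGroup (d : ℕ) :
    BorelSpace (Matrix.orthogonalGroup (Fin d) ℝ) :=
  ⟨rfl⟩

/-- The squared Wasserstein distance of order two, as an infimum over couplings. -/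
def wassersteinSq {X : Type*} [PseudoEMetricSpace X] [MeasurableSpace X] (σ μ : Measure X) :
    ℝ≥0∞ :=
  ⨅ (π : Measure (X × X)) (_ : π.fst = σ) (_ : π.snd = μ), ∫⁻ p, edist p.1 p.2 ^ 2 ∂π

/-- The projection `σ^θ` of `σ` on the direction `θ`: push-forward by `x ↦ ⟨θ, x⟩`. -/
def proj {d : ℕ} (σ : Measure (EuclideanSpace ℝ (Fin d))) (θ : EuclideanSpace ℝ (Fin d)) :
    Measure ℝ :=
  σ.map (fun x => inner ℝ θ x)

/-- The uniform probability distribution on the unit sphere of `ℝ^d`: normalized surface measure. -/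
def uniformSphere (d : ℕ) : Measure (Metric.sphere (0 : EuclideanSpace ℝ (Fin d)) 1) :=
  ((volume : Measure (EuclideanSpace ℝ (Fin d))).toSphere Set.univ)⁻¹ •
    (volume : Measure (EuclideanSpace ℝ (Fin d))).toSphere

/-- The squared Sliced-Wasserstein distance of order two. -/
def slicedWassersteinSq {d : ℕ} (σ μ : Measure (EuclideanSpace ℝ (Fin d))) : ℝ≥0∞ :=
  ∫⁻ θ, wassersteinSq (proj σ (θ : EuclideanSpace ℝ (Fin d)))
    (proj μ (θ : EuclideanSpace ℝ (Fin d))) ∂(uniformSphere d)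

/-- The objective `F(σ) = (d / 2) SW_2^2(σ, μ)`. -/
def objective {d : ℕ} (μ σ : Measure (EuclideanSpace ℝ (Fin d))) : ℝ≥0∞ :=
  (d : ℝ≥0∞) / 2 * slicedWassersteinSq σ μ

/-- The quantile function (generalized inverse of the distribution function) of `ν`. -/
def quantile (ν : Measure ℝ) (u : ℝ) : ℝ :=
  sInf {x : ℝ | u ≤ cdf ν x}

/-- The monotone (optimal transport) map `F_ν⁻¹ ∘ F_ρ` from `ρ` to `ν` on the real line. -/
def transportMap (ρ ν : Measure ℝ) (x : ℝ) : ℝ :=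
  quantile ν (cdf ρ x)

/-- The `i`-th vector `θ_i` of the orthonormal basis `P`: the `i`-th column of the matrix. -/
def direction {d : ℕ} (P : Matrix.orthogonalGroup (Fin d) ℝ) (i : Fin d) :
    EuclideanSpace ℝ (Fin d) :=
  WithLp.toLp 2 (fun j => (P : Matrix (Fin d) (Fin d) ℝ) j i)

/-- The slice-matching map `T_{σ,P}(x) = ∑ i, t_{θ_i}(⟨θ_i, x⟩) θ_i` with target `μ`, where
`t_θ` is the optimal transport map from `σ^θ` to `μ^θ`. -/
def sliceMap {d : ℕ} (σ μ : Measure (EuclideanSpace ℝ (Fin d)))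
    (P : Matrix.orthogonalGroup (Fin d) ℝ) (x : EuclideanSpace ℝ (Fin d)) :
    EuclideanSpace ℝ (Fin d) :=
  ∑ i, transportMap (proj σ (direction P i)) (proj μ (direction P i))
    (inner ℝ (direction P i) x) • direction P i

/-- The iterates of the slice-matching scheme with source `σ`, target `μ`, steps `γ`:
`σ_0 = σ` and `σ_{k+1} = ((1 - γ_k) Id + γ_k T_{σ_k, P_k})_♯ σ_k`. Here `P k` is the basis drawn
in the step from `σ_k` to `σ_{k+1}`. -/
def iterates {d : ℕ} (σ μ : Measure (EuclideanSpace ℝ (Fin d))) (γ : ℕ → ℝ)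
    (P : ℕ → Matrix.orthogonalGroup (Fin d) ℝ) : ℕ → Measure (EuclideanSpace ℝ (Fin d))
  | 0 => σ
  | k + 1 => (iterates σ μ γ P k).map
      (fun x => (1 - γ k) • x + γ k • sliceMap (iterates σ μ γ P k) μ (P k) x)

end SliceMatching

end

/-!
The iterates stay centred Gaussian: on `N(0, Σ)` the one-dimensional optimal maps are
`x ↦ x / σ_i`, with `σ_i = √(θ_iᵀ Σ θ_i)`, so a step with basis `P` and step size `γ` is the linear
map `M = P diag(1 - γ + γ / σ_i) Pᵀ` and replaces `Σ` by `M Σ Mᵀ`. The squared distance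
`W₂²(N(0, s²), N(0, 1))` equals `(s - 1)²`, so the objective is `d / 2` times
`slicedLoss Σ = ∫ (σ_θ - 1)² dU(θ)`.

The Lyapunov function is not the objective but twice the relative entropy,
`entropy Σ = tr Σ - d - log det Σ`. For `0 ≤ γ ≤ 1`, concavity of the logarithm gives,
for every basis, `entropy Σ' + γ ∑ (σ_i - 1)² ≤ entropy Σ` (`entropy_covStep_le`).
This has three consequences.

* The entropy never increases, so all iterates stay in one sublevel set of the entropy, on which the
  eigenvalues are bounded away from zero and infinity.
* With `γ = 1`, since the entropy is nonnegative, `∑ (σ_i - 1)² ≤ entropy Σ` for every basis. A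
  column of a Haar distributed matrix is uniform on the sphere (`lintegral_direction_eq`), so
  `d * slicedLoss Σ ≤ entropy Σ` (`mul_slicedLoss_le_entropy`).
* As the basis drawn in a step is independent of the current iterate, the expected entropy decreases
  by at least `γ_k d` times the expected sliced loss (`lintegral_entropy_covIterates_succ_le`).

Conversely, on a sublevel set of the entropy, `entropy Σ ≤ C slicedLoss Σ`
(`exists_entropy_le_mul_slicedLoss`): both sides are comparable to `∑ (λ_i - 1)²` for the
eigenvalues `λ_i`, the right-hand side because `β ↦ ∫ (∑ β_j θ_j²)² dU(θ)` is a positive definite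
quadratic form. Hence the expected entropy contracts by `1 - c γ_k` in step `k`. As
`γ_k = (k + 1)^{-α}` with `α < 1`, this is eventually at most `k / (k + 1)`, so the expected
entropy is `O(k^{-β})` for every `β ≤ 1`, in particular for `β = 2 α - 1`.
-/

namespace SliceMatching

variable {d : ℕ}

/-! ### The orthogonal group acting on the sphere -/

/-- The linear isometry of `ℝ^d` given by an orthogonal matrix. -/
noncomputable def rotation (Q : Matrix.orthogonalGroup (Fin d) ℝ) :
    EuclideanSpace ℝ (Fin d) ≃ₗᵢ[ℝ] EuclideanSpace ℝ (Fin d) :=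
  Unitary.linearIsometryEquiv ⟨Matrix.toEuclideanCLM (n := Fin d) (𝕜 := ℝ) (Q : Matrix _ _ ℝ),
    Unitary.map_mem (Matrix.toEuclideanCLM (n := Fin d) (𝕜 := ℝ)) Q.2⟩

lemma ofLp_rotation (Q : Matrix.orthogonalGroup (Fin d) ℝ) (x : EuclideanSpace ℝ (Fin d)) :
    (rotation Q x).ofLp = (Q : Matrix (Fin d) (Fin d) ℝ).mulVec x.ofLp := rfl

lemma rotation_direction (Q P : Matrix.orthogonalGroup (Fin d) ℝ) (i : Fin d) :
    rotation Q (direction P i) = direction (Q * P) i := by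
  ext j
  simp [ofLp_rotation, direction, Matrix.mul_apply, Matrix.mulVec, dotProduct]

lemma rotation_single (Q : Matrix.orthogonalGroup (Fin d) ℝ) (i : Fin d) :
    rotation Q (EuclideanSpace.single i 1) = direction Q i := by
  ext j
  simp [ofLp_rotation, direction]

lemma norm_direction (P : Matrix.orthogonalGroup (Fin d) ℝ) (i : Fin d) :
    ‖direction P i‖ = 1 := by
  rw [← rotation_single, LinearIsometryEquiv.norm_map]
  simp

/-- The orthogonal group acts transitively on the unit sphere. -/
lemma exists_direction_eq {θ : EuclideanSpace ℝ (Fin d)} (hθ : ‖θ‖ = 1) (i : Fin d) :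
    ∃ Q : Matrix.orthogonalGroup (Fin d) ℝ, direction Q i = θ := by
  obtain ⟨b, hb⟩ := Orthonormal.exists_orthonormalBasis_extension_of_card_eq (𝕜 := ℝ)
    (E := EuclideanSpace ℝ (Fin d)) (ι := Fin d) (by simp) (v := fun _ => θ) (s := {i})
    (by
      constructor
      · rintro ⟨_, rfl⟩
        exact hθ
      · rintro ⟨_, rfl⟩ ⟨_, rfl⟩ h
        exact absurd rfl h)
  refine ⟨⟨_, (EuclideanSpace.basisFun (Fin d) ℝ).toMatrix_orthonormalBasis_mem_orthogonal b⟩, ?_⟩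
  ext j
  simp [direction, Module.Basis.toMatrix_apply, hb i rfl]

lemma continuous_entry (j k : Fin d) :
    Continuous fun P : Matrix.orthogonalGroup (Fin d) ℝ => (P : Matrix (Fin d) (Fin d) ℝ) j k :=
  continuous_subtype_val.matrix_elem j k

@[fun_prop]
lemma measurable_entry (j k : Fin d) :
    Measurable fun P : Matrix.orthogonalGroup (Fin d) ℝ => (P : Matrix (Fin d) (Fin d) ℝ) j k :=
  (continuous_entry j k).measurable

@[fun_prop]
lemma measurable_direction (i : Fin d) :
    Measurable fun P : Matrix.orthogonalGroup (Fin d) ℝ => direction P i := by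
  unfold direction
  fun_prop

lemma measurable_rotation :
    Measurable fun p : Matrix.orthogonalGroup (Fin d) ℝ × EuclideanSpace ℝ (Fin d) =>
      rotation p.1 p.2 := by
  refine (MeasurableEquiv.toLp 2 (Fin d → ℝ)).symm.measurableEmbedding.measurable_comp_iff.1 ?_
  refine measurable_pi_lambda _ fun j => ?_
  change Measurable fun p : Matrix.orthogonalGroup (Fin d) ℝ × EuclideanSpace ℝ (Fin d) =>
    ∑ k, (p.1 : Matrix (Fin d) (Fin d) ℝ) j k * p.2 k
  refine Finset.measurable_sum _ fun k _ => ?_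
  exact ((measurable_entry j k).comp measurable_fst).mul (by fun_prop)

/-- Averaging a function over the orbit of `θ` under a right-invariant measure does not depend on
the unit vector `θ`, by transitivity. -/
lemma lintegral_rotation_eq_of_isMulRightInvariant
    (η : Measure (Matrix.orthogonalGroup (Fin d) ℝ)) [η.IsMulRightInvariant]
    (g : EuclideanSpace ℝ (Fin d) → ℝ≥0∞) {θ : EuclideanSpace ℝ (Fin d)} (hθ : ‖θ‖ = 1)
    (i : Fin d) :
    ∫⁻ Q, g (rotation Q θ) ∂η = ∫⁻ Q, g (direction Q i) ∂η := by
  obtain ⟨R, rfl⟩ := exists_direction_eq hθ i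
  simp_rw [rotation_direction]
  exact lintegral_mul_right_eq_self (fun Q => g (direction Q i)) R

/-- A rotation-invariant probability measure on the unit sphere is determined by any
right-invariant probability measure on the orthogonal group. -/
lemma lintegral_eq_of_map_rotation_eq
    (η : Measure (Matrix.orthogonalGroup (Fin d) ℝ)) [η.IsMulRightInvariant]
    [IsProbabilityMeasure η] (ν : Measure (EuclideanSpace ℝ (Fin d))) [IsProbabilityMeasure ν]
    (hν : ∀ Q, ν.map (rotation Q) = ν) (hs : ∀ᵐ θ ∂ν, ‖θ‖ = 1)
    {g : EuclideanSpace ℝ (Fin d) → ℝ≥0∞} (hg : Measurable g) (i : Fin d) :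
    ∫⁻ θ, g θ ∂ν = ∫⁻ Q, g (direction Q i) ∂η := by
  calc ∫⁻ θ, g θ ∂ν = ∫⁻ _Q, ∫⁻ θ, g θ ∂ν ∂η := by simp
    _ = ∫⁻ Q, ∫⁻ θ, g (rotation Q θ) ∂ν ∂η := by
        refine lintegral_congr fun Q => ?_
        conv_lhs => rw [← hν Q]
        rw [lintegral_map hg (rotation Q).continuous.measurable]
    _ = ∫⁻ θ, ∫⁻ Q, g (rotation Q θ) ∂η ∂ν :=
        lintegral_lintegral_swap (hg.comp measurable_rotation).aemeasurable
    _ = ∫⁻ _θ, ∫⁻ Q, g (direction Q i) ∂η ∂ν := by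
        refine lintegral_congr_ae ?_
        filter_upwards [hs] with θ hθ
        exact lintegral_rotation_eq_of_isMulRightInvariant η g hθ i
    _ = _ := by simp

/-- The uniform distribution on the unit sphere, as a measure on the ambient space. -/
noncomputable def sphereMeasure (d : ℕ) : Measure (EuclideanSpace ℝ (Fin d)) :=
  (uniformSphere d).map Subtype.val

lemma nontrivial_of_one_le (hd : 1 ≤ d) : Nontrivial (EuclideanSpace ℝ (Fin d)) := by
  have : Nonempty (Fin d) := ⟨⟨0, hd⟩⟩
  infer_instance

lemma isProbabilityMeasure_uniformSphere (hd : 1 ≤ d) :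
    IsProbabilityMeasure (uniformSphere d) := by
  have := nontrivial_of_one_le hd
  constructor
  rw [uniformSphere, Measure.smul_apply, smul_eq_mul, ENNReal.inv_mul_cancel]
  · rw [Ne, Measure.measure_univ_eq_zero]
    exact Measure.toSphere_ne_zero _
  · exact measure_ne_top _ _

lemma isProbabilityMeasure_sphereMeasure (hd : 1 ≤ d) :
    IsProbabilityMeasure (sphereMeasure d) := by
  have := isProbabilityMeasure_uniformSphere hd
  exact Measure.isProbabilityMeasure_map measurable_subtype_coe.aemeasurable

lemma ae_norm_eq_one_sphereMeasure : ∀ᵐ θ ∂(sphereMeasure d), ‖θ‖ = 1 := by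
  rw [sphereMeasure, ae_map_iff measurable_subtype_coe.aemeasurable
    (measurableSet_eq_fun (by fun_prop) (by fun_prop))]
  exact Filter.Eventually.of_forall fun θ => by simp

open Pointwise in
lemma map_rotation_sphereMeasure (Q : Matrix.orthogonalGroup (Fin d) ℝ) :
    (sphereMeasure d).map (rotation Q) = sphereMeasure d := by
  have hm : Measurable (rotation Q) := (rotation Q).continuous.measurable
  ext s hs
  rw [Measure.map_apply hm hs, sphereMeasure, Measure.map_apply measurable_subtype_coe (hm hs),
    Measure.map_apply measurable_subtype_coe hs, uniformSphere, Measure.smul_apply,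
    Measure.smul_apply, Measure.toSphere_apply' _ (measurable_subtype_coe (hm hs)),
    Measure.toSphere_apply' _ (measurable_subtype_coe hs)]
  congr 2
  refine Eq.trans (congrArg _ ?_) ((rotation Q).measurePreserving.measure_preimage_emb
    (rotation Q).toHomeomorph.measurableEmbedding _)
  ext x
  simp only [Set.mem_smul, Set.mem_image, Set.mem_preimage, Subtype.exists, exists_and_left,
    exists_prop, mem_sphere_zero_iff_norm]
  constructor
  · rintro ⟨r, hr, y, ⟨y, hy, h1, rfl⟩, rfl⟩
    exact ⟨r, hr, _, ⟨_, hy, by simpa using h1, rfl⟩, by simp⟩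
  · rintro ⟨r, hr, y, ⟨y, hy, h1, rfl⟩, h⟩
    refine ⟨r, hr, _, ⟨(rotation Q).symm y, by simpa using hy, by simpa using h1, rfl⟩, ?_⟩
    apply (rotation Q).injective
    simp [h]

/-- Each column of a Haar distributed orthogonal matrix is uniformly distributed on the sphere. -/
lemma lintegral_direction_eq (hd : 1 ≤ d)
    (η : Measure (Matrix.orthogonalGroup (Fin d) ℝ)) [η.IsMulLeftInvariant]
    [IsProbabilityMeasure η] {g : EuclideanSpace ℝ (Fin d) → ℝ≥0∞} (hg : Measurable g)
    (i : Fin d) :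
    ∫⁻ Q, g (direction Q i) ∂η = ∫⁻ θ, g θ ∂(sphereMeasure d) := by
  have := isProbabilityMeasure_sphereMeasure hd
  have : IsProbabilityMeasure η.inv := by
    unfold Measure.inv
    exact Measure.isProbabilityMeasure_map measurable_inv.aemeasurable
  have : IsProbabilityMeasure (η.map fun Q => direction Q i) :=
    Measure.isProbabilityMeasure_map (by fun_prop)
  -- `η.inv` is right-invariant, so it serves as the averaging measure for both sides.
  rw [lintegral_eq_of_map_rotation_eq η.inv (sphereMeasure d) map_rotation_sphereMeasure
    ae_norm_eq_one_sphereMeasure hg i, ← lintegral_eq_of_map_rotation_eq η.inv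
      (η.map fun Q => direction Q i) _ _ hg i, lintegral_map hg (by fun_prop)]
  · intro Q
    rw [Measure.map_map (rotation Q).continuous.measurable (by fun_prop)]
    have : (rotation Q ∘ fun P => direction P i) = (fun P => direction P i) ∘ fun P => Q * P := by
      ext1 P
      simp [rotation_direction]
    rw [this, ← Measure.map_map (by fun_prop) (measurable_const_mul Q), map_mul_left_eq_self]
  · rw [ae_map_iff (by fun_prop) (measurableSet_eq_fun (by fun_prop) (by fun_prop))]
    exact Filter.Eventually.of_forall fun P => norm_direction P i

/-- A continuous function that vanishes almost everywhere on the sphere vanishes everywhere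
on it. -/
lemma eq_zero_of_ae_sphereMeasure (hd : 1 ≤ d) {f : EuclideanSpace ℝ (Fin d) → ℝ}
    (hf : Continuous f) (h : ∀ᵐ θ ∂(sphereMeasure d), f θ = 0) {θ : EuclideanSpace ℝ (Fin d)}
    (hθ : ‖θ‖ = 1) : f θ = 0 := by
  have := nontrivial_of_one_le hd
  rw [sphereMeasure, ae_map_iff measurable_subtype_coe.aemeasurable
    (measurableSet_eq_fun (by fun_prop) (by fun_prop)), uniformSphere,
    Measure.ae_ennreal_smul_measure_iff (ENNReal.inv_ne_zero.2 (measure_ne_top _ _))] at h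
  have := (Continuous.ae_eq_iff_eq
    (volume : Measure (EuclideanSpace ℝ (Fin d))).toSphere
    (f := fun x => f x) (g := fun _ => 0) (by fun_prop) (by fun_prop)).1 h
  exact congrFun this ⟨θ, by simpa using hθ⟩

/-! ### Transport between centred Gaussian measures on the line -/

lemma strictMono_cdf_gaussianReal : StrictMono (cdf (gaussianReal 0 1)) := by
  intro x y hxy
  have h : 0 < gaussianReal 0 1 (Set.Ioc x y) := by
    rw [pos_iff_ne_zero]
    intro h0
    have := gaussianReal_absolutelyContinuous' 0 one_ne_zero h0
    simp only [Real.volume_Ioc, ENNReal.ofReal_eq_zero] at this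
    linarith
  rw [← measure_cdf (gaussianReal 0 1), StieltjesFunction.measure_Ioc, ENNReal.ofReal_pos] at h
  linarith

lemma quantile_cdf_of_strictMono {ν : Measure ℝ} (hν : StrictMono (cdf ν)) (x : ℝ) :
    quantile ν (cdf ν x) = x := by
  have : {y : ℝ | cdf ν x ≤ cdf ν y} = Set.Ici x := by
    ext y
    exact hν.le_iff_le
  rw [quantile, this, csInf_Ici]

/-- A centred Gaussian measure is a scaled standard Gaussian measure. -/
lemma gaussianReal_sq_eq_map {s : ℝ} :
    gaussianReal 0 (s ^ 2).toNNReal = (gaussianReal 0 1).map (fun x => s * x) := by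
  rw [gaussianReal_map_const_mul]
  congr 1
  · simp
  · ext
    simp [sq_nonneg]

lemma cdf_gaussianReal_sq {s : ℝ} (hs : 0 < s) (x : ℝ) :
    cdf (gaussianReal 0 (s ^ 2).toNNReal) x = cdf (gaussianReal 0 1) (x / s) := by
  rw [cdf_eq_real, cdf_eq_real, gaussianReal_sq_eq_map, measureReal_def, measureReal_def,
    Measure.map_apply (by fun_prop) measurableSet_Iic]
  congr 2
  ext y
  simp [le_div_iff₀' hs]

/-- The monotone map between two centred Gaussian measures is linear. -/
lemma transportMap_gaussianReal {s : ℝ} (hs : 0 < s) (x : ℝ) :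
    transportMap (gaussianReal 0 (s ^ 2).toNNReal) (gaussianReal 0 1) x = x / s := by
  rw [transportMap, cdf_gaussianReal_sq hs, quantile_cdf_of_strictMono strictMono_cdf_gaussianReal]

lemma eLpNorm_id_gaussianReal_one : eLpNorm (id : ℝ → ℝ) 2 (gaussianReal 0 1) = 1 := by
  rw [MemLp.eLpNorm_eq_integral_rpow_norm two_ne_zero (by simp) (memLp_id_gaussianReal 2)]
  have h : ∫ x, id x ^ 2 ∂(gaussianReal 0 1) = 1 := by
    rw [← variance_of_integral_eq_zero aemeasurable_id (by simp), variance_id_gaussianReal]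
    simp
  simp only [id] at h
  simp [h]

lemma eLpNorm_id_gaussianReal_sq {s : ℝ} (hs : 0 ≤ s) :
    eLpNorm (id : ℝ → ℝ) 2 (gaussianReal 0 (s ^ 2).toNNReal) = ENNReal.ofReal s := by
  have h : (id : ℝ → ℝ) ∘ (fun x => s * x) = s • id := rfl
  rw [gaussianReal_sq_eq_map, eLpNorm_map_measure aestronglyMeasurable_id (by fun_prop), h,
    eLpNorm_const_smul, eLpNorm_id_gaussianReal_one, mul_one, Real.enorm_eq_ofReal hs]

lemma lintegral_edist_sq {π : Measure (ℝ × ℝ)} :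
    ∫⁻ p, edist p.1 p.2 ^ 2 ∂π = eLpNorm (fun p : ℝ × ℝ => p.1 - p.2) 2 π ^ 2 := by
  have := eLpNorm_nnreal_pow_eq_lintegral (μ := π) (f := fun p : ℝ × ℝ => p.1 - p.2)
    (p := 2) two_ne_zero
  simp only [NNReal.coe_ofNat, ENNReal.rpow_ofNat, ENNReal.coe_ofNat] at this
  rw [this]
  simp [edist_eq_enorm_sub]

/-- The squared Wasserstein distance between centred Gaussian measures on the line. The coupling
`(s Z, Z)` realizes the infimum, by the triangle inequality in `L²`. -/
lemma wassersteinSq_gaussianReal {s : ℝ} (hs : 0 ≤ s) :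
    wassersteinSq (gaussianReal 0 (s ^ 2).toNNReal) (gaussianReal 0 1) =
      ENNReal.ofReal ((s - 1) ^ 2) := by
  have key : ENNReal.ofReal ((s - 1) ^ 2) = ENNReal.ofReal |s - 1| ^ 2 := by
    rw [← ENNReal.ofReal_pow (abs_nonneg _), sq_abs]
  refine le_antisymm ?_ ?_
  · refine iInf_le_of_le ((gaussianReal 0 1).map fun x => (s * x, x)) ?_
    refine iInf₂_le_of_le ?_ ?_ ?_
    · rw [Measure.fst_map_prodMk (by fun_prop), gaussianReal_sq_eq_map]
    · rw [Measure.snd_map_prodMk (by fun_prop), Measure.map_id']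
    · rw [lintegral_edist_sq, eLpNorm_map_measure (by fun_prop) (by fun_prop), key]
      have : ((fun p : ℝ × ℝ => p.1 - p.2) ∘ fun x : ℝ => (s * x, x)) = (s - 1) • id := by
        ext x
        simp
        ring
      rw [this, eLpNorm_const_smul, eLpNorm_id_gaussianReal_one, mul_one,
        Real.enorm_eq_ofReal_abs]
  · refine le_iInf fun π => le_iInf₂ fun h1 h2 => ?_
    have e1 : eLpNorm (Prod.fst : ℝ × ℝ → ℝ) 2 π = ENNReal.ofReal s := by
      rw [← eLpNorm_id_gaussianReal_sq hs, ← h1, Measure.fst,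
        eLpNorm_map_measure (by fun_prop) (by fun_prop)]
      rfl
    have e2 : eLpNorm (Prod.snd : ℝ × ℝ → ℝ) 2 π = 1 := by
      rw [← eLpNorm_id_gaussianReal_one, ← h2, Measure.snd,
        eLpNorm_map_measure (by fun_prop) (by fun_prop)]
      rfl
    rw [lintegral_edist_sq, key]
    gcongr
    set D := eLpNorm (fun p : ℝ × ℝ => p.1 - p.2) 2 π with hD
    have t1 : ENNReal.ofReal s ≤ D + 1 := by
      have := eLpNorm_add_le (μ := π) (p := 2) (f := fun p : ℝ × ℝ => p.1 - p.2) (g := Prod.snd)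
        (by fun_prop) (by fun_prop) (by norm_num)
      rw [e2] at this
      convert this using 1
      rw [← e1]
      congr 1
      ext p
      simp
    have t2 : 1 ≤ D + ENNReal.ofReal s := by
      have := eLpNorm_sub_le (μ := π) (p := 2) (f := (Prod.fst : ℝ × ℝ → ℝ))
        (g := fun p : ℝ × ℝ => p.1 - p.2) (by fun_prop) (by fun_prop) (by norm_num)
      rw [e1, add_comm] at this
      convert this using 1
      rw [← e2]
      congr 1
      ext p
      simp
    rcases le_total 1 s with h | h
    · rw [abs_of_nonneg (by linarith), ENNReal.ofReal_sub _ zero_le_one, ENNReal.ofReal_one]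
      exact tsub_le_iff_right.2 t1
    · rw [abs_of_nonpos (by linarith), neg_sub, ENNReal.ofReal_sub _ hs, ENNReal.ofReal_one]
      exact tsub_le_iff_right.2 t2

/-! ### The slice-matching step on centred Gaussian measures -/

/-- The standard deviation of `N(0, Σ)` in the direction `θ`. -/
noncomputable def stdDev (S : Matrix (Fin d) (Fin d) ℝ) (θ : EuclideanSpace ℝ (Fin d)) : ℝ :=
  √(θ.ofLp ⬝ᵥ S.mulVec θ.ofLp)

lemma stdDev_sq {S : Matrix (Fin d) (Fin d) ℝ} (hS : S.PosSemidef)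
    (θ : EuclideanSpace ℝ (Fin d)) : stdDev S θ ^ 2 = θ.ofLp ⬝ᵥ S.mulVec θ.ofLp :=
  Real.sq_sqrt (by simpa using hS.dotProduct_mulVec_nonneg θ.ofLp)

lemma stdDev_nonneg (S : Matrix (Fin d) (Fin d) ℝ) (θ : EuclideanSpace ℝ (Fin d)) :
    0 ≤ stdDev S θ := Real.sqrt_nonneg _

lemma stdDev_pos {S : Matrix (Fin d) (Fin d) ℝ} (hS : S.PosDef)
    {θ : EuclideanSpace ℝ (Fin d)} (hθ : ‖θ‖ = 1) : 0 < stdDev S θ := by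
  refine Real.sqrt_pos.2 ?_
  have : θ.ofLp ≠ 0 := by
    intro h
    have : θ = 0 := by ext i; simp [h]
    simp [this] at hθ
  simpa using hS.dotProduct_mulVec_pos this

lemma stdDev_one {θ : EuclideanSpace ℝ (Fin d)} (hθ : ‖θ‖ = 1) :
    stdDev (1 : Matrix (Fin d) (Fin d) ℝ) θ = 1 := by
  have : θ.ofLp ⬝ᵥ θ.ofLp = ‖θ‖ ^ 2 := by
    rw [EuclideanSpace.real_norm_sq_eq]
    simp [dotProduct, sq]
  simp [stdDev, this, hθ]

lemma proj_multivariateGaussian {S : Matrix (Fin d) (Fin d) ℝ} (hS : S.PosSemidef)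
    (θ : EuclideanSpace ℝ (Fin d)) :
    proj (multivariateGaussian 0 S) θ = gaussianReal 0 (stdDev S θ ^ 2).toNNReal := by
  have h := IsGaussian.map_eq_gaussianReal (μ := multivariateGaussian 0 S) (innerSL ℝ θ)
  have hv : Var[fun x => inner ℝ θ x; multivariateGaussian 0 S] = stdDev S θ ^ 2 := by
    rw [← covarianceBilin_self IsGaussian.memLp_two_id, covarianceBilin_multivariateGaussian hS,
      stdDev_sq hS]
  have h0 : ∫ x, (innerSL ℝ θ) x ∂(multivariateGaussian 0 S) = 0 := by
    rw [ContinuousLinearMap.integral_comp_id_comm IsGaussian.integrable_id]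
    simp
  rw [h0] at h
  rw [← hv]
  exact h

lemma proj_multivariateGaussian_one {θ : EuclideanSpace ℝ (Fin d)} (hθ : ‖θ‖ = 1) :
    proj (multivariateGaussian 0 (1 : Matrix (Fin d) (Fin d) ℝ)) θ = gaussianReal 0 1 := by
  rw [proj_multivariateGaussian Matrix.PosSemidef.one, stdDev_one hθ]
  simp

/-- The sliced loss `∫ (σ_θ - 1)² dU(θ)` of a covariance matrix. -/
noncomputable def slicedLoss (S : Matrix (Fin d) (Fin d) ℝ) : ℝ≥0∞ :=
  ∫⁻ θ, ENNReal.ofReal ((stdDev S θ - 1) ^ 2) ∂(sphereMeasure d)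

lemma continuous_stdDev (S : Matrix (Fin d) (Fin d) ℝ) : Continuous (stdDev S) := by
  unfold stdDev
  fun_prop

lemma objective_multivariateGaussian {S : Matrix (Fin d) (Fin d) ℝ} (hS : S.PosSemidef) :
    objective (multivariateGaussian 0 1) (multivariateGaussian 0 S) =
      (d : ℝ≥0∞) / 2 * slicedLoss S := by
  have := continuous_stdDev S
  rw [objective, slicedWassersteinSq, slicedLoss, sphereMeasure,
    lintegral_map (by fun_prop) measurable_subtype_coe]
  congr 1
  refine lintegral_congr fun θ => ?_
  rw [proj_multivariateGaussian_one (by simp), proj_multivariateGaussian hS,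
    wassersteinSq_gaussianReal (stdDev_nonneg _ _)]

lemma map_toEuclideanCLM_multivariateGaussian {S : Matrix (Fin d) (Fin d) ℝ}
    (hS : S.PosSemidef) (M : Matrix (Fin d) (Fin d) ℝ) :
    (multivariateGaussian 0 S).map (Matrix.toEuclideanCLM (n := Fin d) (𝕜 := ℝ) M) =
      multivariateGaussian 0 (M * S * M.transpose) := by
  have hS' : (M * S * M.transpose).PosSemidef := by
    simpa using hS.mul_mul_conjTranspose_same M
  refine Measure.ext_of_charFun ?_
  ext t
  rw [charFun_multivariateGaussian hS', charFun_apply,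
    integral_map (by fun_prop) (by fun_prop)]
  have h (x : EuclideanSpace ℝ (Fin d)) :
      inner ℝ (Matrix.toEuclideanCLM (n := Fin d) (𝕜 := ℝ) M x) t =
        inner ℝ x (WithLp.toLp 2 (M.transpose.mulVec t.ofLp)) := by
    rw [real_inner_comm, Matrix.inner_toEuclideanCLM, real_inner_comm, Matrix.dotProduct_mulVec,
      EuclideanSpace.inner_eq_star_dotProduct, Matrix.mulVec_transpose, dotProduct_comm]
    simp
  simp_rw [h]
  rw [← charFun_apply, charFun_multivariateGaussian hS]
  congr 3
  · simp
  · rw [← Matrix.mulVec_mulVec, ← Matrix.mulVec_mulVec, Matrix.dotProduct_mulVec t.ofLp M,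
      Matrix.mulVec_transpose]

/-- The factor `1 - γ + γ / σ_i` by which the slice-matching step stretches the direction `θ_i`. -/
noncomputable def stretch (γ : ℝ) (S : Matrix (Fin d) (Fin d) ℝ)
    (P : Matrix.orthogonalGroup (Fin d) ℝ) (i : Fin d) : ℝ :=
  1 - γ + γ / stdDev S (direction P i)

/-- The matrix of the linear map `(1 - γ) Id + γ T` in a slice-matching step. -/
noncomputable def stepMatrix (γ : ℝ) (S : Matrix (Fin d) (Fin d) ℝ)
    (P : Matrix.orthogonalGroup (Fin d) ℝ) : Matrix (Fin d) (Fin d) ℝ :=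
  (P : Matrix (Fin d) (Fin d) ℝ) * Matrix.diagonal (stretch γ S P) *
    (P : Matrix (Fin d) (Fin d) ℝ).transpose

/-- The covariance matrix after a slice-matching step. -/
noncomputable def covStep (γ : ℝ) (S : Matrix (Fin d) (Fin d) ℝ)
    (P : Matrix.orthogonalGroup (Fin d) ℝ) : Matrix (Fin d) (Fin d) ℝ :=
  stepMatrix γ S P * S * (stepMatrix γ S P).transpose

lemma coe_mul_transpose (P : Matrix.orthogonalGroup (Fin d) ℝ) :
    (P : Matrix (Fin d) (Fin d) ℝ) * (P : Matrix (Fin d) (Fin d) ℝ).transpose = 1 :=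
  (Matrix.mem_orthogonalGroup_iff _ _).1 P.2

lemma transpose_mul_coe (P : Matrix.orthogonalGroup (Fin d) ℝ) :
    (P : Matrix (Fin d) (Fin d) ℝ).transpose * (P : Matrix (Fin d) (Fin d) ℝ) = 1 :=
  (Matrix.mem_orthogonalGroup_iff' _ _).1 P.2

lemma inner_direction (P : Matrix.orthogonalGroup (Fin d) ℝ) (i : Fin d)
    (x : EuclideanSpace ℝ (Fin d)) :
    inner ℝ (direction P i) x = (P : Matrix (Fin d) (Fin d) ℝ).transpose.mulVec x.ofLp i := by
  simp [direction, EuclideanSpace.inner_eq_star_dotProduct, Matrix.mulVec, dotProduct, mul_comm]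

lemma toEuclideanCLM_stepMatrix {S : Matrix (Fin d) (Fin d) ℝ} (hS : S.PosDef) (γ : ℝ)
    (P : Matrix.orthogonalGroup (Fin d) ℝ) (x : EuclideanSpace ℝ (Fin d)) :
    (1 - γ) • x + γ • sliceMap (multivariateGaussian 0 S) (multivariateGaussian 0 1) P x =
      Matrix.toEuclideanCLM (n := Fin d) (𝕜 := ℝ) (stepMatrix γ S P) x := by
  have hT : sliceMap (multivariateGaussian 0 S) (multivariateGaussian 0 1) P x =
      ∑ i, (inner ℝ (direction P i) x / stdDev S (direction P i)) • direction P i := by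
    refine Finset.sum_congr rfl fun i _ => ?_
    rw [proj_multivariateGaussian_one (norm_direction P i),
      proj_multivariateGaussian hS.posSemidef,
      transportMap_gaussianReal (stdDev_pos hS (norm_direction P i))]
  have hx : x.ofLp = (P : Matrix (Fin d) (Fin d) ℝ).mulVec
      ((P : Matrix (Fin d) (Fin d) ℝ).transpose.mulVec x.ofLp) := by
    rw [Matrix.mulVec_mulVec, coe_mul_transpose, Matrix.one_mulVec]
  ext j
  rw [hT, Matrix.ofLp_toEuclideanCLM, stepMatrix, ← Matrix.mulVec_mulVec, ← Matrix.mulVec_mulVec]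
  have hxj : x j = ∑ i, (P : Matrix (Fin d) (Fin d) ℝ) j i * inner ℝ (direction P i) x := by
    conv_lhs => rw [hx]
    simp_rw [inner_direction]
    rfl
  simp only [PiLp.add_apply, PiLp.smul_apply, WithLp.ofLp_sum, Finset.sum_apply, hxj, smul_eq_mul,
    Finset.mul_sum, ← Finset.sum_add_distrib]
  rw [Matrix.mulVec, dotProduct]
  refine Finset.sum_congr rfl fun i _ => ?_
  rw [Matrix.mulVec_diagonal, ← inner_direction]
  simp only [direction, stretch]
  ring

/-- The covariance matrices of the slice-matching iterates of a centred Gaussian measure. -/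
noncomputable def covIterates (S : Matrix (Fin d) (Fin d) ℝ) (γ : ℕ → ℝ)
    (P : ℕ → Matrix.orthogonalGroup (Fin d) ℝ) : ℕ → Matrix (Fin d) (Fin d) ℝ
  | 0 => S
  | k + 1 => covStep (γ k) (covIterates S γ P k) (P k)

lemma stretch_pos {γ : ℝ} (h0 : 0 ≤ γ) (h1 : γ ≤ 1) {S : Matrix (Fin d) (Fin d) ℝ}
    (hS : S.PosDef) (P : Matrix.orthogonalGroup (Fin d) ℝ) (i : Fin d) : 0 < stretch γ S P i := by
  have hs := stdDev_pos hS (norm_direction P i)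
  have h := div_nonneg h0 hs.le
  rcases h1.lt_or_eq with h1 | rfl
  · rw [stretch]
    linarith
  · simpa [stretch] using hs

lemma det_stepMatrix (γ : ℝ) (S : Matrix (Fin d) (Fin d) ℝ)
    (P : Matrix.orthogonalGroup (Fin d) ℝ) : (stepMatrix γ S P).det = ∏ i, stretch γ S P i := by
  have h : (P : Matrix (Fin d) (Fin d) ℝ).det *
      (P : Matrix (Fin d) (Fin d) ℝ).transpose.det = 1 := by
    rw [← Matrix.det_mul, coe_mul_transpose, Matrix.det_one]
  rw [stepMatrix, Matrix.det_mul, Matrix.det_mul, Matrix.det_diagonal, mul_right_comm, h, one_mul]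

lemma posDef_covStep {γ : ℝ} (h0 : 0 ≤ γ) (h1 : γ ≤ 1) {S : Matrix (Fin d) (Fin d) ℝ}
    (hS : S.PosDef) (P : Matrix.orthogonalGroup (Fin d) ℝ) : (covStep γ S P).PosDef := by
  have hdet : IsUnit (stepMatrix γ S P) := by
    rw [Matrix.isUnit_iff_isUnit_det, det_stepMatrix]
    exact (Finset.prod_pos fun i _ => stretch_pos h0 h1 hS P i).ne'.isUnit
  simpa [covStep] using hS.mul_mul_conjTranspose_same (B := stepMatrix γ S P)
    (Matrix.vecMul_injective_of_isUnit hdet)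

lemma posDef_covIterates {S : Matrix (Fin d) (Fin d) ℝ} (hS : S.PosDef) {γ : ℕ → ℝ}
    (h0 : ∀ k, 0 ≤ γ k) (h1 : ∀ k, γ k ≤ 1) (P : ℕ → Matrix.orthogonalGroup (Fin d) ℝ) (k : ℕ) :
    (covIterates S γ P k).PosDef := by
  induction k with
  | zero => exact hS
  | succ k ih => exact posDef_covStep (h0 k) (h1 k) ih (P k)

/-- The slice-matching iterates stay centred Gaussian measures. -/
lemma iterates_multivariateGaussian {S : Matrix (Fin d) (Fin d) ℝ} (hS : S.PosDef) {γ : ℕ → ℝ}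
    (h0 : ∀ k, 0 ≤ γ k) (h1 : ∀ k, γ k ≤ 1) (P : ℕ → Matrix.orthogonalGroup (Fin d) ℝ) (k : ℕ) :
    iterates (multivariateGaussian 0 S) (multivariateGaussian 0 1) γ P k =
      multivariateGaussian 0 (covIterates S γ P k) := by
  induction k with
  | zero => rfl
  | succ k ih =>
    have hk := posDef_covIterates hS h0 h1 P k
    rw [iterates, ih, covIterates, covStep, ← map_toEuclideanCLM_multivariateGaussian hk.posSemidef]
    congr 1
    ext1 x
    exact toEuclideanCLM_stepMatrix hk _ _ _

/-! ### The relative entropy decreases along the iteration -/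

/-- Twice the relative entropy of `N(0, Σ)` with respect to the standard Gaussian measure. -/
noncomputable def entropy (S : Matrix (Fin d) (Fin d) ℝ) : ℝ :=
  S.trace - d - Real.log S.det

lemma conj_apply_self {S : Matrix (Fin d) (Fin d) ℝ} (hS : S.PosSemidef)
    (P : Matrix.orthogonalGroup (Fin d) ℝ) (i : Fin d) :
    ((P : Matrix (Fin d) (Fin d) ℝ).transpose * S * (P : Matrix (Fin d) (Fin d) ℝ)) i i =
      stdDev S (direction P i) ^ 2 := by
  rw [stdDev_sq hS, Matrix.mul_assoc, Matrix.mul_apply]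
  rfl

lemma trace_eq_sum_stdDev_sq {S : Matrix (Fin d) (Fin d) ℝ} (hS : S.PosSemidef)
    (P : Matrix.orthogonalGroup (Fin d) ℝ) :
    S.trace = ∑ i, stdDev S (direction P i) ^ 2 := by
  simp_rw [← conj_apply_self hS P]
  change _ = Matrix.trace _
  rw [Matrix.trace_mul_comm, ← Matrix.mul_assoc, coe_mul_transpose, Matrix.one_mul]

lemma trace_covStep {γ : ℝ} {S : Matrix (Fin d) (Fin d) ℝ}
    (hS : S.PosSemidef) (P : Matrix.orthogonalGroup (Fin d) ℝ) :
    (covStep γ S P).trace = ∑ i, (stretch γ S P i * stdDev S (direction P i)) ^ 2 := by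
  set D := Matrix.diagonal (stretch γ S P)
  have h : covStep γ S P = (P : Matrix (Fin d) (Fin d) ℝ) *
      (D * ((P : Matrix (Fin d) (Fin d) ℝ).transpose * S * (P : Matrix (Fin d) (Fin d) ℝ)) * D) *
      (P : Matrix (Fin d) (Fin d) ℝ).transpose := by
    simp only [covStep, stepMatrix, Matrix.transpose_mul, Matrix.transpose_transpose, D,
      Matrix.diagonal_transpose, Matrix.mul_assoc]
  rw [h, Matrix.mul_assoc, Matrix.trace_mul_comm, Matrix.mul_assoc, transpose_mul_coe,
    Matrix.mul_one]
  refine Finset.sum_congr rfl fun i _ => ?_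
  rw [Matrix.diag_apply, Matrix.mul_diagonal, Matrix.diagonal_mul, conj_apply_self hS]
  ring

lemma log_det_covStep {γ : ℝ} (h0 : 0 ≤ γ) (h1 : γ ≤ 1) {S : Matrix (Fin d) (Fin d) ℝ}
    (hS : S.PosDef) (P : Matrix.orthogonalGroup (Fin d) ℝ) :
    Real.log (covStep γ S P).det = Real.log S.det + 2 * ∑ i, Real.log (stretch γ S P i) := by
  have hm : ∏ i, stretch γ S P i ≠ 0 :=
    (Finset.prod_pos fun i _ => stretch_pos h0 h1 hS P i).ne'
  rw [covStep, Matrix.det_mul, Matrix.det_mul, Matrix.det_transpose, det_stepMatrix,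
    Real.log_mul (mul_ne_zero hm hS.det_pos.ne') hm, Real.log_mul hm hS.det_pos.ne',
    Real.log_prod fun i _ => (stretch_pos h0 h1 hS P i).ne']
  ring

/-- The one-dimensional inequality behind the decay of the entropy, from the concavity of the
logarithm and `log s ≤ s - 1`. -/
lemma entropy_scalar_le {γ s : ℝ} (h0 : 0 ≤ γ) (h1 : γ ≤ 1) (hs : 0 < s) :
    ((1 - γ + γ / s) * s) ^ 2 - s ^ 2 - 2 * Real.log (1 - γ + γ / s) ≤ -(γ * (s - 1) ^ 2) := by
  have hlog : -(γ * Real.log s) ≤ Real.log (1 - γ + γ / s) := by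
    have := strictConcaveOn_log_Ioi.concaveOn.2 (Set.mem_Ioi.2 one_pos)
      (Set.mem_Ioi.2 (inv_pos.2 hs)) (sub_nonneg.2 h1) h0 (by ring)
    simpa [div_eq_mul_inv] using this
  have hlog' := mul_le_mul_of_nonneg_left (Real.log_le_sub_one_of_pos hs) h0
  have e : (1 - γ + γ / s) * s = (1 - γ) * s + γ := by
    field_simp
  rw [e]
  nlinarith [mul_nonneg h0 (mul_nonneg (sub_nonneg.2 h1) (sq_nonneg (s - 1)))]

/-- A slice-matching step decreases the entropy by at least `γ ∑ (σ_i - 1)²`. -/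
lemma entropy_covStep_le {γ : ℝ} (h0 : 0 ≤ γ) (h1 : γ ≤ 1) {S : Matrix (Fin d) (Fin d) ℝ}
    (hS : S.PosDef) (P : Matrix.orthogonalGroup (Fin d) ℝ) :
    entropy (covStep γ S P) + γ * ∑ i, (stdDev S (direction P i) - 1) ^ 2 ≤ entropy S := by
  rw [entropy, entropy, trace_covStep hS.posSemidef, log_det_covStep h0 h1 hS,
    trace_eq_sum_stdDev_sq hS.posSemidef P]
  have := Finset.sum_le_sum fun i (_ : i ∈ Finset.univ) =>
    entropy_scalar_le h0 h1 (stdDev_pos hS (norm_direction P i))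
  simp only [Finset.sum_sub_distrib, Finset.sum_neg_distrib, ← Finset.mul_sum] at this
  simp only [stretch]
  linarith

lemma entropy_eq_sum_eigenvalues {S : Matrix (Fin d) (Fin d) ℝ} (hS : S.PosDef) :
    entropy S =
      ∑ i, (hS.isHermitian.eigenvalues i - 1 - Real.log (hS.isHermitian.eigenvalues i)) := by
  rw [entropy, hS.isHermitian.trace_eq_sum_eigenvalues, hS.isHermitian.det_eq_prod_eigenvalues]
  simp only [RCLike.ofReal_real_eq_id, id]
  rw [Real.log_prod fun i _ => (hS.eigenvalues_pos i).ne']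
  simp [Finset.sum_sub_distrib]

lemma entropy_nonneg {S : Matrix (Fin d) (Fin d) ℝ} (hS : S.PosDef) : 0 ≤ entropy S := by
  rw [entropy_eq_sum_eigenvalues hS]
  refine Finset.sum_nonneg fun i _ => ?_
  have := Real.log_le_sub_one_of_pos (hS.eigenvalues_pos i)
  linarith

lemma entropy_covStep_le_entropy {γ : ℝ} (h0 : 0 ≤ γ) (h1 : γ ≤ 1)
    {S : Matrix (Fin d) (Fin d) ℝ} (hS : S.PosDef) (P : Matrix.orthogonalGroup (Fin d) ℝ) :
    entropy (covStep γ S P) ≤ entropy S := by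
  have := entropy_covStep_le h0 h1 hS P
  have : 0 ≤ γ * ∑ i, (stdDev S (direction P i) - 1) ^ 2 := by positivity
  linarith

/-- The entropy dominates the slice-matching loss in every orthonormal basis: a full step
`γ = 1` cannot decrease the entropy below zero. -/
lemma sum_stdDev_sub_one_sq_le_entropy {S : Matrix (Fin d) (Fin d) ℝ} (hS : S.PosDef)
    (P : Matrix.orthogonalGroup (Fin d) ℝ) :
    ∑ i, (stdDev S (direction P i) - 1) ^ 2 ≤ entropy S := by
  have h := entropy_covStep_le zero_le_one le_rfl hS P
  have := entropy_nonneg (posDef_covStep zero_le_one le_rfl hS P)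
  linarith

lemma entropy_covIterates_le {S : Matrix (Fin d) (Fin d) ℝ} (hS : S.PosDef) {γ : ℕ → ℝ}
    (h0 : ∀ k, 0 ≤ γ k) (h1 : ∀ k, γ k ≤ 1) (P : ℕ → Matrix.orthogonalGroup (Fin d) ℝ) (k : ℕ) :
    entropy (covIterates S γ P k) ≤ entropy S := by
  induction k with
  | zero => exact le_rfl
  | succ k ih =>
    exact (entropy_covStep_le_entropy (h0 k) (h1 k) (posDef_covIterates hS h0 h1 P k) (P k)).trans
      ih

/-! ### The sliced loss controls the entropy -/

/-- The quadratic form `β ↦ ∫ (∑ β_j θ_j²)² dU(θ)` is positive definite, by compactness of the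
sphere of all `β` and since the uniform distribution charges every open set. -/
lemma exists_pos_mul_sum_sq_le_lintegral (hd : 1 ≤ d) :
    ∃ c : ℝ, 0 < c ∧ ∀ β : EuclideanSpace ℝ (Fin d), ENNReal.ofReal (c * ∑ j, β j ^ 2) ≤
      ∫⁻ θ, ENNReal.ofReal ((∑ j, β j * θ j ^ 2) ^ 2) ∂(sphereMeasure d) := by
  have := nontrivial_of_one_le hd
  have := isProbabilityMeasure_uniformSphere hd
  set f : EuclideanSpace ℝ (Fin d) → Metric.sphere (0 : EuclideanSpace ℝ (Fin d)) 1 → ℝ :=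
    fun β θ => (∑ j, β j * (θ : EuclideanSpace ℝ (Fin d)) j ^ 2) ^ 2 with hf
  have hcont : Continuous f.uncurry := by
    simp only [hf, Function.uncurry_def]
    fun_prop
  set q : EuclideanSpace ℝ (Fin d) → ℝ := fun β => ∫ θ, f β θ ∂(uniformSphere d) with hq
  have hint (β) : Integrable (f β) (uniformSphere d) :=
    (hcont.uncurry_left β).integrable_of_hasCompactSupport (HasCompactSupport.of_compactSpace _)
  have hqc : Continuous q := by
    have := continuous_parametric_integral_of_continuous (μ := uniformSphere d) hcont
      (isCompact_univ (X := Metric.sphere (0 : EuclideanSpace ℝ (Fin d)) 1))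
    simpa using this
  have hq_eq (β) : ∫⁻ θ, ENNReal.ofReal ((∑ j, β j * θ j ^ 2) ^ 2) ∂(sphereMeasure d) =
      ENNReal.ofReal (q β) := by
    rw [sphereMeasure, lintegral_map (by fun_prop) measurable_subtype_coe,
      ofReal_integral_eq_lintegral_ofReal (hint β)
        (Filter.Eventually.of_forall fun θ => sq_nonneg _)]
  obtain ⟨β₀, hβ₀, hmin⟩ := (isCompact_sphere (0 : EuclideanSpace ℝ (Fin d)) 1).exists_isMinOn
    (NormedSpace.sphere_nonempty.2 zero_le_one) hqc.continuousOn
  refine ⟨q β₀, ?_, fun β => ?_⟩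
  · refine lt_of_le_of_ne (integral_nonneg fun θ => sq_nonneg _) fun h0 => ?_
    have h1 := (integral_eq_zero_iff_of_nonneg (fun θ => sq_nonneg _) (hint β₀)).1 h0.symm
    have h2 : ∀ᵐ θ ∂(sphereMeasure d), (∑ j, β₀ j * θ j ^ 2) ^ 2 = 0 := by
      rw [sphereMeasure, ae_map_iff measurable_subtype_coe.aemeasurable
        (measurableSet_eq_fun (by fun_prop) (by fun_prop))]
      exact h1
    have h3 : β₀ = 0 := by
      ext j
      have := eq_zero_of_ae_sphereMeasure hd (by fun_prop) h2
        (θ := EuclideanSpace.single j 1) (by simp)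
      simpa [Pi.single_apply] using this
    simp [h3] at hβ₀
  · rw [hq_eq]
    refine ENNReal.ofReal_le_ofReal ?_
    rw [← EuclideanSpace.real_norm_sq_eq]
    rcases eq_or_ne β 0 with rfl | hβ
    · simpa using integral_nonneg fun θ => sq_nonneg _
    have hn : ‖β‖ ≠ 0 := norm_ne_zero_iff.2 hβ
    have h1 : q β₀ ≤ q (‖β‖⁻¹ • β) := hmin (by simp [norm_smul, hn])
    have h2 : q (‖β‖⁻¹ • β) = (‖β‖⁻¹) ^ 2 * q β := by
      simp only [hq, hf, ← integral_const_mul]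
      congr 1
      ext θ
      rw [← mul_pow, Finset.mul_sum]
      simp [mul_assoc]
    rw [h2, inv_pow, inv_mul_eq_div, le_div_iff₀ (by positivity)] at h1
    exact h1

lemma stdDev_rotation_eigenvectorUnitary_sq {S : Matrix (Fin d) (Fin d) ℝ} (hS : S.PosDef)
    (θ : EuclideanSpace ℝ (Fin d)) :
    stdDev S (rotation hS.isHermitian.eigenvectorUnitary θ) ^ 2 =
      ∑ j, hS.isHermitian.eigenvalues j * θ j ^ 2 := by
  set V : Matrix.orthogonalGroup (Fin d) ℝ := hS.isHermitian.eigenvectorUnitary with hV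
  have hspec : (V : Matrix (Fin d) (Fin d) ℝ).transpose * S * (V : Matrix (Fin d) (Fin d) ℝ) =
      Matrix.diagonal hS.isHermitian.eigenvalues := by
    have h := hS.isHermitian.spectral_theorem
    rw [Unitary.conjStarAlgAut_apply] at h
    have h' : S = (V : Matrix (Fin d) (Fin d) ℝ) * Matrix.diagonal hS.isHermitian.eigenvalues *
      (V : Matrix (Fin d) (Fin d) ℝ).transpose := h
    conv_lhs => rw [h']
    calc _ = ((V : Matrix (Fin d) (Fin d) ℝ).transpose * V) *
        Matrix.diagonal hS.isHermitian.eigenvalues *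
        ((V : Matrix (Fin d) (Fin d) ℝ).transpose * V) := by simp only [Matrix.mul_assoc]
      _ = _ := by rw [transpose_mul_coe, Matrix.one_mul, Matrix.mul_one]
  have hconj : ((V : Matrix (Fin d) (Fin d) ℝ).mulVec θ.ofLp) ⬝ᵥ
      S.mulVec ((V : Matrix (Fin d) (Fin d) ℝ).mulVec θ.ofLp) =
      θ.ofLp ⬝ᵥ (Matrix.diagonal hS.isHermitian.eigenvalues).mulVec θ.ofLp := by
    rw [← hspec, ← Matrix.mulVec_mulVec, ← Matrix.mulVec_mulVec,
      Matrix.dotProduct_mulVec θ.ofLp, Matrix.vecMul_transpose]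
  rw [stdDev_sq hS.posSemidef, ofLp_rotation, hconj, dotProduct]
  refine Finset.sum_congr rfl fun j _ => ?_
  rw [Matrix.mulVec_diagonal]
  ring

lemma stdDev_le_of_entropy_le (hd : 1 ≤ d) {S : Matrix (Fin d) (Fin d) ℝ} (hS : S.PosDef) {w : ℝ}
    (hw : entropy S ≤ w) {θ : EuclideanSpace ℝ (Fin d)} (hθ : ‖θ‖ = 1) :
    stdDev S θ ≤ 1 + √w := by
  obtain ⟨P, rfl⟩ := exists_direction_eq hθ ⟨0, hd⟩
  have h : (stdDev S (direction P ⟨0, hd⟩) - 1) ^ 2 ≤ w :=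
    (Finset.single_le_sum (f := fun i => (stdDev S (direction P i) - 1) ^ 2)
      (fun i _ => sq_nonneg _) (Finset.mem_univ _)).trans
      ((sum_stdDev_sub_one_sq_le_entropy hS P).trans hw)
  linarith [le_abs_self (stdDev S (direction P ⟨0, hd⟩) - 1), Real.abs_le_sqrt h]

lemma exp_le_eigenvalues_of_entropy_le {S : Matrix (Fin d) (Fin d) ℝ} (hS : S.PosDef) {w : ℝ}
    (hw : entropy S ≤ w) (i : Fin d) : Real.exp (-(w + 1)) ≤ hS.isHermitian.eigenvalues i := by
  have hpos := hS.eigenvalues_pos i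
  rw [← Real.le_log_iff_exp_le hpos]
  rw [entropy_eq_sum_eigenvalues hS] at hw
  have h : hS.isHermitian.eigenvalues i - 1 - Real.log (hS.isHermitian.eigenvalues i) ≤ _ :=
    Finset.single_le_sum
    (f := fun i => hS.isHermitian.eigenvalues i - 1 - Real.log (hS.isHermitian.eigenvalues i))
    (fun i _ => by linarith [Real.log_le_sub_one_of_pos (hS.eigenvalues_pos i)])
    (Finset.mem_univ i)
  linarith

lemma entropy_le_of_le_eigenvalues {S : Matrix (Fin d) (Fin d) ℝ} (hS : S.PosDef) {a : ℝ}
    (ha : 0 < a) (h : ∀ i, a ≤ hS.isHermitian.eigenvalues i) :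
    entropy S ≤ a⁻¹ * ∑ i, (hS.isHermitian.eigenvalues i - 1) ^ 2 := by
  rw [entropy_eq_sum_eigenvalues hS, Finset.mul_sum]
  refine Finset.sum_le_sum fun i _ => ?_
  have hpos := hS.eigenvalues_pos i
  have h1 := Real.one_sub_inv_le_log_of_pos hpos
  have h2 : (hS.isHermitian.eigenvalues i)⁻¹ * (hS.isHermitian.eigenvalues i - 1) ^ 2 =
      hS.isHermitian.eigenvalues i - 2 + (hS.isHermitian.eigenvalues i)⁻¹ := by
    field_simp
    ring
  have h3 : (hS.isHermitian.eigenvalues i)⁻¹ * (hS.isHermitian.eigenvalues i - 1) ^ 2 ≤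
      a⁻¹ * (hS.isHermitian.eigenvalues i - 1) ^ 2 := by
    have := h i
    gcongr
  linarith

/-- On each sublevel set of the entropy, the entropy is bounded by a multiple of the sliced loss:
both are comparable to `∑ (λ_i - 1)²`, where `λ_i` are the eigenvalues. -/
lemma exists_entropy_le_mul_slicedLoss (hd : 1 ≤ d) (w : ℝ) :
    ∃ C : ℝ, 0 < C ∧ ∀ S : Matrix (Fin d) (Fin d) ℝ, S.PosDef → entropy S ≤ w →
      ENNReal.ofReal (entropy S) ≤ ENNReal.ofReal C * slicedLoss S := by
  obtain ⟨c, hc, hq⟩ := exists_pos_mul_sum_sq_le_lintegral hd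
  set a := Real.exp (-(w + 1)) with ha
  have hapos : 0 < a := Real.exp_pos _
  set K := (2 + √w) ^ 2 with hK
  have hKpos : 0 < K := by positivity
  refine ⟨a⁻¹ * c⁻¹ * K, by positivity, fun S hS hw => ?_⟩
  set β : EuclideanSpace ℝ (Fin d) := WithLp.toLp 2
    fun j => hS.isHermitian.eigenvalues j - 1 with hβ
  have h1 : ENNReal.ofReal (c * ∑ j, β j ^ 2) ≤ ENNReal.ofReal K * slicedLoss S := by
    refine (hq β).trans ?_
    have hcont := continuous_stdDev S
    have hrot : slicedLoss S = ∫⁻ θ, ENNReal.ofReal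
        ((stdDev S (rotation hS.isHermitian.eigenvectorUnitary θ) - 1) ^ 2) ∂(sphereMeasure d) := by
      rw [slicedLoss]
      conv_lhs => rw [← map_rotation_sphereMeasure hS.isHermitian.eigenvectorUnitary]
      rw [lintegral_map (by fun_prop) (rotation _).continuous.measurable]
    rw [hrot, ← lintegral_const_mul' _ _ ENNReal.ofReal_ne_top]
    refine lintegral_mono_ae ?_
    filter_upwards [ae_norm_eq_one_sphereMeasure] with θ hθ
    rw [← ENNReal.ofReal_mul hKpos.le]
    refine ENNReal.ofReal_le_ofReal ?_
    set s := stdDev S (rotation hS.isHermitian.eigenvectorUnitary θ) with hs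
    have hs0 : 0 ≤ s := stdDev_nonneg _ _
    have hs1 : s ≤ 1 + √w := stdDev_le_of_entropy_le hd hS hw (by simpa using hθ)
    have e : ∑ j, β j * θ j ^ 2 = (s + 1) * (s - 1) := by
      have : ∑ j, θ j ^ 2 = 1 := by
        rw [← EuclideanSpace.real_norm_sq_eq, hθ, one_pow]
      simp only [hβ, sub_mul, Finset.sum_sub_distrib, one_mul, this,
        ← stdDev_rotation_eigenvectorUnitary_sq hS, ← hs]
      ring
    rw [e, mul_pow, hK]
    exact mul_le_mul_of_nonneg_right (pow_le_pow_left₀ (by linarith) (by linarith) 2) (sq_nonneg _)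
  calc ENNReal.ofReal (entropy S) ≤ ENNReal.ofReal (a⁻¹ * c⁻¹ * (c * ∑ j, β j ^ 2)) := by
        refine ENNReal.ofReal_le_ofReal ?_
        rw [mul_assoc, inv_mul_cancel_left₀ hc.ne']
        exact entropy_le_of_le_eigenvalues hS hapos (exp_le_eigenvalues_of_entropy_le hS hw)
    _ ≤ ENNReal.ofReal (a⁻¹ * c⁻¹) * (ENNReal.ofReal K * slicedLoss S) := by
        rw [ENNReal.ofReal_mul (by positivity)]
        gcongr
    _ = _ := by
        rw [← mul_assoc, ← ENNReal.ofReal_mul (by positivity)]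

/-- The average of the slice-matching loss over a Haar distributed basis. -/
lemma lintegral_sum_stdDev_sub_one_sq (hd : 1 ≤ d)
    (η : Measure (Matrix.orthogonalGroup (Fin d) ℝ)) [η.IsMulLeftInvariant]
    [IsProbabilityMeasure η] (S : Matrix (Fin d) (Fin d) ℝ) :
    ∫⁻ Q, ENNReal.ofReal (∑ i, (stdDev S (direction Q i) - 1) ^ 2) ∂η = d * slicedLoss S := by
  have hcont := continuous_stdDev S
  simp_rw [ENNReal.ofReal_sum_of_nonneg fun i _ => sq_nonneg _]
  have hg : Measurable fun θ : EuclideanSpace ℝ (Fin d) =>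
      ENNReal.ofReal ((stdDev S θ - 1) ^ 2) := by
    fun_prop
  rw [lintegral_finsetSum (f := fun i Q => ENNReal.ofReal ((stdDev S (direction Q i) - 1) ^ 2)) _
    fun i _ => hg.comp (measurable_direction i)]
  simp [lintegral_direction_eq hd η hg, slicedLoss]

lemma mul_slicedLoss_le_entropy (hd : 1 ≤ d)
    (η : Measure (Matrix.orthogonalGroup (Fin d) ℝ)) [η.IsMulLeftInvariant]
    [IsProbabilityMeasure η] {S : Matrix (Fin d) (Fin d) ℝ} (hS : S.PosDef) :
    d * slicedLoss S ≤ ENNReal.ofReal (entropy S) := by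
  rw [← lintegral_sum_stdDev_sub_one_sq hd η S]
  refine (lintegral_mono fun Q => ENNReal.ofReal_le_ofReal
    (sum_stdDev_sub_one_sq_le_entropy hS Q)).trans ?_
  simp

/-! ### A recursive inequality -/

/-- A sequence that contracts by the factor `1 - c / (k + 1)^α` with `α < 1` is `O(k^{-β})` for
each `0 ≤ β ≤ 1`: eventually the contraction factor is at most `k / (k + 1)`. -/
lemma exists_le_div_rpow_of_recursive_le {α β c w : ℝ} (hα : α < 1) (hβ0 : 0 ≤ β) (hβ : β ≤ 1)
    (hc : 0 < c) :
    ∃ C : ℝ, 0 < C ∧ ∀ u : ℕ → ℝ, (∀ k, 0 ≤ u k) → (∀ k, u k ≤ w) →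
      (∀ k, u (k + 1) ≤ (1 - 1 / ((k : ℝ) + 1) ^ α * c) * u k) →
      ∀ k : ℕ, 1 ≤ k → u k ≤ C / (k : ℝ) ^ β := by
  have hlim : Filter.Tendsto (fun k : ℕ => ((k : ℝ) + 1) ^ (1 - α)) Filter.atTop Filter.atTop :=
    (tendsto_rpow_atTop (by linarith)).comp
      (Filter.tendsto_atTop_add_const_right _ _ tendsto_natCast_atTop_atTop)
  obtain ⟨K, hK⟩ := Filter.eventually_atTop.1 (hlim.eventually_ge_atTop c⁻¹)
  refine ⟨(|w| + 1) * ((K : ℝ) + 1) ^ β, by positivity, fun u hu0 huw hu k hk => ?_⟩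
  have hk0 : (0 : ℝ) < k := by exact_mod_cast hk
  rw [le_div_iff₀ (by positivity)]
  have small (j : ℕ) (hj : j ≤ K + 1) : u j * (j : ℝ) ^ β ≤ (|w| + 1) * ((K : ℝ) + 1) ^ β := by
    have h1 : u j ≤ |w| + 1 := (huw j).trans (by linarith [le_abs_self w])
    have h2 : (j : ℝ) ≤ (K : ℝ) + 1 := by exact_mod_cast hj
    gcongr
  rcases le_total k (K + 1) with hkK | hkK
  · exact small k hkK
  induction k, hkK using Nat.le_induction with
  | base => exact small _ le_rfl
  | succ k hkK ih =>
    have hk1 : 1 ≤ k := by omega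
    have hkp : (0 : ℝ) < k := by exact_mod_cast hk1
    refine le_trans ?_ (ih hk1 hkp)
    have hfac : 1 - 1 / ((k : ℝ) + 1) ^ α * c ≤ k / (k + 1) := by
      have h1 := hK k (by omega)
      rw [Real.rpow_sub (by positivity), Real.rpow_one, inv_le_iff_one_le_mul₀' hc] at h1
      have h2 : 1 / ((k : ℝ) + 1) ≤ 1 / ((k : ℝ) + 1) ^ α * c := by
        rw [div_le_iff₀ (by positivity)]
        calc (1 : ℝ) ≤ _ := h1
          _ = _ := by ring
      have h3 : (k : ℝ) / (k + 1) = 1 - 1 / (k + 1) := by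
        field_simp
        ring
      linarith
    have hle : (k : ℝ) / (k + 1) ≤ (k / (k + 1)) ^ β :=
      Real.self_le_rpow_of_le_one (by positivity)
        ((div_le_one (by positivity)).2 (by linarith)) hβ
    push_cast
    calc u (k + 1) * ((k : ℝ) + 1) ^ β
        ≤ ((k / (k + 1)) ^ β * u k) * ((k : ℝ) + 1) ^ β := by
          gcongr
          exact (hu k).trans (mul_le_mul_of_nonneg_right (hfac.trans hle) (hu0 k))
      _ = u k * (k : ℝ) ^ β := by
          rw [Real.div_rpow hkp.le (by positivity)]
          field_simp

/-! ### Randomness of the iteration -/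

lemma measurable_stdDev {X : Type*} [MeasurableSpace X] {A : X → Matrix (Fin d) (Fin d) ℝ}
    (hA : ∀ i j, Measurable fun x => A x i j) {θ : X → EuclideanSpace ℝ (Fin d)}
    (hθ : Measurable θ) : Measurable fun x => stdDev (A x) (θ x) := by
  simp only [stdDev, dotProduct, Matrix.mulVec]
  fun_prop

lemma measurable_mul_entry {X : Type*} [MeasurableSpace X] {A B : X → Matrix (Fin d) (Fin d) ℝ}
    (hA : ∀ i j, Measurable fun x => A x i j) (hB : ∀ i j, Measurable fun x => B x i j)
    (i j : Fin d) : Measurable fun x => (A x * B x) i j := by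
  simp only [Matrix.mul_apply]
  fun_prop

lemma measurable_covStep {X : Type*} [MeasurableSpace X] {A : X → Matrix (Fin d) (Fin d) ℝ}
    (hA : ∀ i j, Measurable fun x => A x i j) (γ : ℝ) {P : X → Matrix.orthogonalGroup (Fin d) ℝ}
    (hP : Measurable P) (i j : Fin d) : Measurable fun x => covStep γ (A x) (P x) i j := by
  have hPe (i j : Fin d) : Measurable fun x => (P x : Matrix (Fin d) (Fin d) ℝ) i j :=
    (measurable_entry i j).comp hP
  have hstep (i j : Fin d) : Measurable fun x => stepMatrix γ (A x) (P x) i j := by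
    refine measurable_mul_entry (measurable_mul_entry hPe fun i j => ?_) (fun i j => hPe j i) i j
    simp only [Matrix.diagonal_apply]
    split_ifs
    · exact ((measurable_stdDev hA ((measurable_direction i).comp hP)).const_div γ).const_add _
    · exact measurable_const
  exact measurable_mul_entry (measurable_mul_entry hstep hA) (fun i j => hstep j i) i j

lemma measurable_covIterates {X : Type*} [MeasurableSpace X] (S : Matrix (Fin d) (Fin d) ℝ)
    (γ : ℕ → ℝ) {P : ℕ → X → Matrix.orthogonalGroup (Fin d) ℝ} (hP : ∀ k, Measurable (P k))
    (k : ℕ) (i j : Fin d) :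
    Measurable fun x => covIterates S γ (fun n => P n x) k i j := by
  induction k generalizing i j with
  | zero => exact measurable_const
  | succ k ih => exact measurable_covStep ih (γ k) (hP k) i j

lemma measurable_slicedLoss (hd : 1 ≤ d) {X : Type*} [MeasurableSpace X]
    {A : X → Matrix (Fin d) (Fin d) ℝ} (hA : ∀ i j, Measurable fun x => A x i j) :
    Measurable fun x => slicedLoss (A x) := by
  have := isProbabilityMeasure_sphereMeasure hd
  have h : Measurable fun p : X × EuclideanSpace ℝ (Fin d) => stdDev (A p.1) p.2 :=
    measurable_stdDev (fun i j => (hA i j).comp measurable_fst) measurable_snd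
  exact ((h.sub_const 1).pow_const 2).ennreal_ofReal.lintegral_prod_right'

lemma measurable_entropy {X : Type*} [MeasurableSpace X]
    {A : X → Matrix (Fin d) (Fin d) ℝ} (hA : ∀ i j, Measurable fun x => A x i j) :
    Measurable fun x => entropy (A x) := by
  simp only [entropy, Matrix.trace, Matrix.diag, Matrix.det_apply]
  refine ((Finset.measurable_sum _ fun i _ => hA i i).sub_const _).sub (Measurable.log ?_)
  exact Finset.measurable_sum _ fun σ _ =>
    (Finset.measurable_prod _ fun i _ => hA _ _).const_smul _

lemma covIterates_congr (S : Matrix (Fin d) (Fin d) ℝ) (γ : ℕ → ℝ)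
    {P Q : ℕ → Matrix.orthogonalGroup (Fin d) ℝ} {k : ℕ} (h : ∀ j < k, P j = Q j) :
    covIterates S γ P k = covIterates S γ Q k := by
  induction k with
  | zero => rfl
  | succ k ih =>
    rw [covIterates, covIterates, ih fun j hj => h j (by omega), h k (by omega)]

/-- The basis drawn in a step is independent of the current iterate, so the expected slice-matching
loss is the expected sliced loss. -/
lemma lintegral_sum_stdDev_covIterates (hd : 1 ≤ d) (S : Matrix (Fin d) (Fin d) ℝ) (γ : ℕ → ℝ)
    {Ω : Type*} [MeasurableSpace Ω] {Prb : Measure Ω} [IsProbabilityMeasure Prb]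
    {P : ℕ → Ω → Matrix.orthogonalGroup (Fin d) ℝ} (hP : ∀ k, Measurable (P k))
    (hHaar : ∀ k, (Prb.map (P k)).IsHaarMeasure) (hindep : iIndepFun P Prb) (k : ℕ) :
    ∫⁻ ω, ENNReal.ofReal (∑ i, (stdDev (covIterates S γ (fun n => P n ω) k)
        (direction (P k ω) i) - 1) ^ 2) ∂Prb =
      d * ∫⁻ ω, slicedLoss (covIterates S γ (fun n => P n ω) k) ∂Prb := by
  have := hHaar k
  have : IsProbabilityMeasure (Prb.map (P k)) :=
    Measure.isProbabilityMeasure_map (hP k).aemeasurable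
  -- The `k`-th iterate is a function `A` of the first `k` bases, the others being irrelevant.
  let X : Ω → Finset.range k → Matrix.orthogonalGroup (Fin d) ℝ := fun ω j => P j ω
  let extend : ℕ → (Finset.range k → Matrix.orthogonalGroup (Fin d) ℝ) →
      Matrix.orthogonalGroup (Fin d) ℝ := fun n x => if h : n ∈ Finset.range k then x ⟨n, h⟩ else 1
  let A : (Finset.range k → Matrix.orthogonalGroup (Fin d) ℝ) → Matrix (Fin d) (Fin d) ℝ :=
    fun x => covIterates S γ (fun n => extend n x) k
  have hX : Measurable X := measurable_pi_lambda _ fun j => hP j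
  have hext (n : ℕ) : Measurable (extend n) := by
    by_cases h : n ∈ Finset.range k
    · simpa only [extend, h, dite_true] using measurable_pi_apply _
    · simpa only [extend, h, dite_false] using measurable_const
  have hA : ∀ i j, Measurable fun x => A x i j := measurable_covIterates S γ hext k
  have hAX (ω : Ω) : covIterates S γ (fun n => P n ω) k = A (X ω) :=
    covIterates_congr S γ fun j hj => by simp [extend, X, hj]
  have hXP : IndepFun X (P k) Prb := by
    have h := hindep.indepFun_finset (Finset.range k) {k} (by simp) hP
    exact h.comp measurable_id (measurable_pi_apply (⟨k, by simp⟩ : ({k} : Finset ℕ)))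
  have hmap := (indepFun_iff_map_prod_eq_prod_map_map hX.aemeasurable (hP k).aemeasurable).1 hXP
  let f : (Finset.range k → Matrix.orthogonalGroup (Fin d) ℝ) ×
      Matrix.orthogonalGroup (Fin d) ℝ → ℝ≥0∞ := fun p =>
    ENNReal.ofReal (∑ i, (stdDev (A p.1) (direction p.2 i) - 1) ^ 2)
  have hf : Measurable f :=
    (Finset.measurable_sum _ fun i _ => ((measurable_stdDev
      (fun i j => (hA i j).comp measurable_fst)
      ((measurable_direction i).comp measurable_snd)).sub_const 1).pow_const 2).ennreal_ofReal
  simp_rw [hAX]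
  calc _ = ∫⁻ ω, f (X ω, P k ω) ∂Prb := rfl
    _ = ∫⁻ x, ∫⁻ Q, f (x, Q) ∂(Prb.map (P k)) ∂(Prb.map X) := by
        rw [← lintegral_prod _ hf.aemeasurable, ← hmap, lintegral_map hf (hX.prodMk (hP k))]
    _ = ∫⁻ x, d * slicedLoss (A x) ∂(Prb.map X) := by
        simp only [f, lintegral_sum_stdDev_sub_one_sq hd (Prb.map (P k))]
    _ = _ := by
        rw [lintegral_const_mul _ (measurable_slicedLoss hd hA),
          lintegral_map (measurable_slicedLoss hd hA) hX]

/-- The expected entropy decreases by at least `γ_k d` times the expected sliced loss. -/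
lemma lintegral_entropy_covIterates_succ_le (hd : 1 ≤ d) {S : Matrix (Fin d) (Fin d) ℝ}
    (hS : S.PosDef) {γ : ℕ → ℝ} (h0 : ∀ k, 0 ≤ γ k) (h1 : ∀ k, γ k ≤ 1)
    {Ω : Type*} [MeasurableSpace Ω] {Prb : Measure Ω} [IsProbabilityMeasure Prb]
    {P : ℕ → Ω → Matrix.orthogonalGroup (Fin d) ℝ} (hP : ∀ k, Measurable (P k))
    (hHaar : ∀ k, (Prb.map (P k)).IsHaarMeasure) (hindep : iIndepFun P Prb) (k : ℕ) :
    ∫⁻ ω, ENNReal.ofReal (entropy (covIterates S γ (fun n => P n ω) (k + 1))) ∂Prb +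
      ENNReal.ofReal (γ k) * (d * ∫⁻ ω, slicedLoss (covIterates S γ (fun n => P n ω) k) ∂Prb) ≤
      ∫⁻ ω, ENNReal.ofReal (entropy (covIterates S γ (fun n => P n ω) k)) ∂Prb := by
  rw [← lintegral_sum_stdDev_covIterates hd S γ hP hHaar hindep,
    ← lintegral_const_mul' _ _ ENNReal.ofReal_ne_top, ← lintegral_add_left
      (measurable_entropy (measurable_covIterates S γ hP (k + 1))).ennreal_ofReal]
  refine lintegral_mono fun ω => ?_
  have hpos := posDef_covIterates hS h0 h1 (fun n => P n ω)
  rw [← ENNReal.ofReal_mul (h0 k), ← ENNReal.ofReal_add (entropy_nonneg (hpos (k + 1)))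
    (mul_nonneg (h0 k) (Finset.sum_nonneg fun i _ => sq_nonneg _))]
  exact ENNReal.ofReal_le_ofReal (entropy_covStep_le (h0 k) (h1 k) (hpos k) (P k ω))

/-- The expected entropy of the iterates contracts by a factor `1 - c γ_k`. -/
lemma exists_expected_entropy_contraction (hd : 1 ≤ d) {S : Matrix (Fin d) (Fin d) ℝ}
    (hS : S.PosDef) :
    ∃ c : ℝ, 0 < c ∧ ∀ (γ : ℕ → ℝ) (_ : ∀ k, 0 ≤ γ k) (_ : ∀ k, γ k ≤ 1)
      (Ω : Type*) [MeasurableSpace Ω] (Prb : Measure Ω) [IsProbabilityMeasure Prb]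
      (P : ℕ → Ω → Matrix.orthogonalGroup (Fin d) ℝ) (_ : ∀ k, Measurable (P k))
      (_ : ∀ k, (Prb.map (P k)).IsHaarMeasure) (_ : iIndepFun P Prb) (k : ℕ),
      (∫⁻ ω, ENNReal.ofReal (entropy (covIterates S γ (fun n => P n ω) (k + 1))) ∂Prb).toReal ≤
        (1 - γ k * c) *
          (∫⁻ ω, ENNReal.ofReal (entropy (covIterates S γ (fun n => P n ω) k)) ∂Prb).toReal := by
  obtain ⟨C, hC, hCS⟩ := exists_entropy_le_mul_slicedLoss hd (entropy S)
  refine ⟨C⁻¹, inv_pos.2 hC, fun γ h0 h1 Ω _ Prb _ P hP hHaar hindep k => ?_⟩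
  have hdec := lintegral_entropy_covIterates_succ_le hd hS h0 h1 hP hHaar hindep k
  have hpos (ω : Ω) := posDef_covIterates hS h0 h1 (fun n => P n ω)
  have hle (ω : Ω) := entropy_covIterates_le hS h0 h1 (fun n => P n ω)
  have hlow : ∫⁻ ω, ENNReal.ofReal (entropy (covIterates S γ (fun n => P n ω) k)) ∂Prb ≤
      ENNReal.ofReal C * ∫⁻ ω, slicedLoss (covIterates S γ (fun n => P n ω) k) ∂Prb := by
    rw [← lintegral_const_mul' _ _ ENNReal.ofReal_ne_top]
    exact lintegral_mono fun ω => hCS _ (hpos ω k) (hle ω k)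
  have hfin : ∫⁻ ω, ENNReal.ofReal (entropy (covIterates S γ (fun n => P n ω) k)) ∂Prb ≠ ∞ := by
    refine ne_top_of_le_ne_top (b := ENNReal.ofReal (entropy S)) ENNReal.ofReal_ne_top ?_
    refine (lintegral_mono fun ω => ENNReal.ofReal_le_ofReal (hle ω k)).trans ?_
    simp
  set w := ∫⁻ ω, ENNReal.ofReal (entropy (covIterates S γ (fun n => P n ω) k)) ∂Prb
  set w' := ∫⁻ ω, ENNReal.ofReal (entropy (covIterates S γ (fun n => P n ω) (k + 1))) ∂Prb
  set g := ∫⁻ ω, slicedLoss (covIterates S γ (fun n => P n ω) k) ∂Prb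
  have hg : ENNReal.ofReal C⁻¹ * w ≤ d * g := by
    calc ENNReal.ofReal C⁻¹ * w ≤ ENNReal.ofReal C⁻¹ * (ENNReal.ofReal C * g) := by gcongr
      _ = 1 * g := by
          rw [← mul_assoc, ← ENNReal.ofReal_mul (inv_nonneg.2 hC.le), inv_mul_cancel₀ hC.ne',
            ENNReal.ofReal_one]
      _ ≤ d * g := by
          gcongr
          exact_mod_cast hd
  have h2 : w' + ENNReal.ofReal (γ k) * (ENNReal.ofReal C⁻¹ * w) ≤ w :=
    le_trans (by gcongr) hdec
  have h3 := ENNReal.toReal_mono hfin h2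
  have hw' : w' ≠ ∞ := ne_top_of_le_ne_top hfin (le_self_add.trans h2)
  rw [ENNReal.toReal_add hw' (by finiteness), ENNReal.toReal_mul, ENNReal.toReal_mul,
    ENNReal.toReal_ofReal (h0 k), ENNReal.toReal_ofReal (inv_nonneg.2 hC.le)] at h3
  linarith

end SliceMatching

theorem mainTheorem1 (d : ℕ) (hd : 1 ≤ d) (S : Matrix (Fin d) (Fin d) ℝ) (hS : S.PosDef)
    (α : ℝ) (hα : 1 / 2 < α) (hα' : α < 1) :
    ∃ C : ℝ, 0 < C ∧
      ∀ (Ω : Type*) [MeasurableSpace Ω] (Prb : Measure Ω) [IsProbabilityMeasure Prb]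
        (P : ℕ → Ω → Matrix.orthogonalGroup (Fin d) ℝ),
        (∀ k, Measurable (P k)) →
        (∀ k, (Prb.map (P k)).IsHaarMeasure) →
        iIndepFun P Prb →
        ∀ k : ℕ, 1 ≤ k →
          AEMeasurable (fun ω => SliceMatching.objective (multivariateGaussian 0 1)
            (SliceMatching.iterates (multivariateGaussian 0 S) (multivariateGaussian 0 1)
              (fun j => 1 / ((j : ℝ) + 1) ^ α) (fun j => P j ω) k)) Prb ∧
          ∫⁻ ω, SliceMatching.objective (multivariateGaussian 0 1)
            (SliceMatching.iterates (multivariateGaussian 0 S) (multivariateGaussian 0 1)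
              (fun j => 1 / ((j : ℝ) + 1) ^ α) (fun j => P j ω) k) ∂Prb
            ≤ ENNReal.ofReal (C / (k : ℝ) ^ (2 * α - 1)) := by
  obtain ⟨c, hc, hcontr⟩ := SliceMatching.exists_expected_entropy_contraction hd hS
  obtain ⟨C, hC, hrate⟩ := SliceMatching.exists_le_div_rpow_of_recursive_le
    (α := α) (β := 2 * α - 1) (c := c) (w := SliceMatching.entropy S) hα' (by linarith)
    (by linarith) hc
  refine ⟨C, hC, fun Ω _ Prb _ P hP hHaar hindep k hk => ?_⟩
  set γ : ℕ → ℝ := fun j => 1 / ((j : ℝ) + 1) ^ α with hγ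
  have h0 (j : ℕ) : 0 ≤ γ j := by positivity
  have h1 (j : ℕ) : γ j ≤ 1 := by
    refine (div_le_one (by positivity)).2 (Real.one_le_rpow ?_ (by linarith))
    linarith [(Nat.cast_nonneg j : (0 : ℝ) ≤ j)]
  have hpos (ω : Ω) := SliceMatching.posDef_covIterates hS h0 h1 (fun n => P n ω)
  have hle (ω : Ω) := SliceMatching.entropy_covIterates_le hS h0 h1 (fun n => P n ω)
  have hobj (ω : Ω) : SliceMatching.objective (multivariateGaussian 0 1)
      (SliceMatching.iterates (multivariateGaussian 0 S) (multivariateGaussian 0 1) γ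
        (fun j => P j ω) k) =
      (d : ℝ≥0∞) / 2 * SliceMatching.slicedLoss
        (SliceMatching.covIterates S γ (fun j => P j ω) k) := by
    rw [SliceMatching.iterates_multivariateGaussian hS h0 h1,
      SliceMatching.objective_multivariateGaussian (hpos ω k).posSemidef]
  simp_rw [hobj]
  refine ⟨((SliceMatching.measurable_slicedLoss hd
    (SliceMatching.measurable_covIterates S γ hP k)).const_mul _).aemeasurable, ?_⟩
  have hfin (j : ℕ) : ∫⁻ ω, ENNReal.ofReal (SliceMatching.entropy
      (SliceMatching.covIterates S γ (fun n => P n ω) j)) ∂Prb ≤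
      ENNReal.ofReal (SliceMatching.entropy S) := by
    refine (lintegral_mono fun ω => ENNReal.ofReal_le_ofReal (hle ω j)).trans ?_
    simp
  have hk' := hrate
    (fun j => (∫⁻ ω, ENNReal.ofReal (SliceMatching.entropy
      (SliceMatching.covIterates S γ (fun n => P n ω) j)) ∂Prb).toReal)
    (fun j => ENNReal.toReal_nonneg)
    (fun j => ENNReal.toReal_le_of_le_ofReal (SliceMatching.entropy_nonneg hS) (hfin j))
    (fun j => hcontr γ h0 h1 Ω Prb P hP hHaar hindep j) k hk
  refine le_trans ?_ (ENNReal.ofReal_le_ofReal hk')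
  rw [ENNReal.ofReal_toReal (ne_top_of_le_ne_top ENNReal.ofReal_ne_top (hfin k))]
  refine lintegral_mono fun ω => ?_
  have := hHaar 0
  have : IsProbabilityMeasure (Prb.map (P 0)) :=
    Measure.isProbabilityMeasure_map (hP 0).aemeasurable
  refine le_trans ?_ (SliceMatching.mul_slicedLoss_le_entropy hd (Prb.map (P 0)) (hpos ω k))
  gcongr
  exact ENNReal.half_le_self
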